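/- Let $N\ge 3$ and let $\mathcal G=C_N$ be the cycle graph on the vertex set $\{0,1,\dots,N-1\}$ ($i$ and $i'$ adjacent iff $i-i'\equiv\pm1 \pmod N$), with Laplacian matrix $L$. Let $(x_1(t),x_2(t))_{t\ge 0}$ be an $\mathbb R^N\times\mathbb R^N$-valued continuous process with square-integrable initial state that solves the noisy second-order consensus dynamics $$\dot x_1(t)=x_2(t),\qquad \dot x_2(t)=-Lx_1(t)-Lx_2(t)+w(t),$$ where $w$ is an $N$-vector of independent standard (unit-intensity) Gaussian white noise processes; that is, $dx_1=x_2\,dt$ and $dx_2=(-Lx_1-Lx_2)\,dt+dW$, with $W$ a standard $N$-dimensional Brownian motion. Put $\bar x_1(t)=\frac1N\sum_{j} x_{1j}(t)$ and $$H_{SO}(j,k)=\lim_{t\to\infty}\mathbb E\big[(x_{1j}(t)-x_{1k}(t))^2\big],\quad H_{SO}(j)=\lim_{t\to\infty}\mathbb E\big[(x_{1j}(t)-\bar x_1(t))^2\big],\quad H_{SO}(\mathcal G)=\lim_{t\to\infty}\sum_{j=0}^{N-1}\mathbb E\big[(x_{1j}(t)-\bar x_1(t))^2\big].$$ Then these expectations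 are finite, these limits exist, and 1. for all vertices $k\le j$, with $l=j-k$, $$H_{SO}(j,k)=\frac{l^4}{24N}-\frac{l^3}{12}+\frac{l^2N}{24}-\frac{l^2}{12N}+\frac{l}{12};$$ 2. for every vertex $j$, $\displaystyle H_{SO}(j)=\frac{1}{1440}\Big(N^3+10N-\frac{11}{N}\Big)$; 3. $\displaystyle H_{SO}(\mathcal G)=\frac{1}{1440}\big(N^4+10N^2-11\big)$. In particular $H_{SO}(C_N)=\Theta(N^4)$ as $N\to\infty$. -/

import Mathlib

open MeasureTheory ProbabilityTheory Filter Topology Asymptotics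
open scoped NNReal Matrix

/-- A family of independent standard real Brownian motions, one for each `j : V`. Its formal time
derivative is a vector of uncorrelated Gaussian white noise processes of unit intensity. -/
structure IsBrownianVector {V Ω : Type*} [MeasurableSpace Ω]
    (P : Measure Ω) (W : ℝ≥0 → Ω → V → ℝ) : Prop where
  isBrownianReal : ∀ j, IsBrownianReal (fun t ω => W t ω j) P
  iIndepFun : iIndepFun (fun (j : V) (ω : Ω) (t : ℝ≥0) => W t ω j) P

/-- `(x₁, x₂)` is a solution of the noisy second-order consensus dynamics
`ẋ₁ = x₂`, `ẋ₂ = - L x₁ - L x₂ + w` on the graph `G` with Laplacian `L`, where the white noise `w`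
is the formal derivative of `W`. The noise being additive, the stochastic differential equation
`dx₁ = x₂ dt`, `dx₂ = (- L x₁ - L x₂) dt + dW` is the pathwise integral equation below. The initial
state is any square-integrable random vector. -/
structure IsNoisyConsensus {V Ω : Type*} [Fintype V] [DecidableEq V] [MeasurableSpace Ω]
    (G : SimpleGraph V) [DecidableRel G.Adj] (P : Measure Ω)
    (W x₁ x₂ : ℝ≥0 → Ω → V → ℝ) : Prop where
  noise : IsBrownianVector P W
  aemeasurable_fst : ∀ t j, AEMeasurable (fun ω => x₁ t ω j) P
  aemeasurable_snd : ∀ t j, AEMeasurable (fun ω => x₂ t ω j) P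
  continuous_fst : ∀ᵐ ω ∂P, Continuous fun t => x₁ t ω
  continuous_snd : ∀ᵐ ω ∂P, Continuous fun t => x₂ t ω
  memLp_fst_zero : ∀ j, MemLp (fun ω => x₁ 0 ω j) 2 P
  memLp_snd_zero : ∀ j, MemLp (fun ω => x₂ 0 ω j) 2 P
  fst_eq : ∀ᵐ ω ∂P, ∀ (t : ℝ≥0) (j : V),
    x₁ t ω j = x₁ 0 ω j + ∫ s in (0 : ℝ)..t, x₂ s.toNNReal ω j
  snd_eq : ∀ᵐ ω ∂P, ∀ (t : ℝ≥0) (j : V),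
    x₂ t ω j = x₂ 0 ω j
      + (∫ s in (0 : ℝ)..t,
          (-(G.lapMatrix ℝ *ᵥ x₁ s.toNNReal ω) j - (G.lapMatrix ℝ *ᵥ x₂ s.toNNReal ω) j))
      + W t ω j

/-- The average of the coordinates of a vector. -/
noncomputable def vertexAverage {V : Type*} [Fintype V] (y : V → ℝ) : ℝ :=
  (∑ i, y i) / Fintype.card V

/-- `v = lim_{t → ∞} 𝔼[(x₁ⱼ(t) - x₁ₖ(t))²]`, all these expectations being finite and the limit
existing. -/
def HasPairwiseVariance {V Ω : Type*} [MeasurableSpace Ω]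
    (P : Measure Ω) (x₁ : ℝ≥0 → Ω → V → ℝ) (j k : V) (v : ℝ) : Prop :=
  (∀ t, Integrable (fun ω => (x₁ t ω j - x₁ t ω k) ^ 2) P) ∧
    Tendsto (fun t => ∫ ω, (x₁ t ω j - x₁ t ω k) ^ 2 ∂P) atTop (𝓝 v)

/-- `v = lim_{t → ∞} 𝔼[(x₁ⱼ(t) - x̄₁(t))²]`, all these expectations being finite and the limit
existing. -/
def HasVertexVariance {V Ω : Type*} [Fintype V] [MeasurableSpace Ω]
    (P : Measure Ω) (x₁ : ℝ≥0 → Ω → V → ℝ) (j : V) (v : ℝ) : Prop :=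
  (∀ t, Integrable (fun ω => (x₁ t ω j - vertexAverage (x₁ t ω)) ^ 2) P) ∧
    Tendsto (fun t => ∫ ω, (x₁ t ω j - vertexAverage (x₁ t ω)) ^ 2 ∂P) atTop (𝓝 v)

/-- `v = lim_{t → ∞} ∑ⱼ 𝔼[(x₁ⱼ(t) - x̄₁(t))²]`, all these expectations being finite and the limit
existing. -/
def HasTotalVariance {V Ω : Type*} [Fintype V] [MeasurableSpace Ω]
    (P : Measure Ω) (x₁ : ℝ≥0 → Ω → V → ℝ) (v : ℝ) : Prop :=
  (∀ t j, Integrable (fun ω => (x₁ t ω j - vertexAverage (x₁ t ω)) ^ 2) P) ∧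
    Tendsto (fun t => ∑ j, ∫ ω, (x₁ t ω j - vertexAverage (x₁ t ω)) ^ 2 ∂P) atTop (𝓝 v)

/-! The proof diagonalises nothing. Write `A` for the Laplacian. A statistic `a ⬝ᵥ x₁ t` with `a` of
zero sum is written as `(A *ᵥ v) ⬝ᵥ x₁ t` with `v` of zero sum, and its limiting second moment is
shown to be `(v ⬝ᵥ v) / 2` on every connected graph (`IsNoisyConsensus.tendsto_integral_sq`).

To see this, pair the state with the transposed linear system `r' = -A s`, `s' = r - A s`, started
at `(v, 0)` and run backwards in time. This expresses the statistic at time `t` as `(A r(t)) · x₁(0)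
+ (A s(t)) · x₂(0)` plus the Wiener integral of `A s(t - u)` against `dW(u)`. The isometry gives
that integral the second moment `∫₀ᵗ |A s|²`. The energy `|r|² + s · A s` has derivative `-2 |A
s|²`, so the integral equals half the energy lost, `(|v|² - energy(t)) / 2`. On a connected graph
the energy tends to zero (`IsAdjointFlow.tendsto_energy`), which also removes the contribution of
the initial state.

On the cycle it remains to solve `A φ = a` for `a = e_j - e_k` and `a = e_j - 1/N`. The solutions
are explicit piecewise linear and piecewise quadratic functions, and half of their centred sum of
squares is a combination of power sums. -/

/-! ### Calculus and inequalities for the dot product -/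

theorem HasDerivAt.dotProduct_vec {V : Type*} [Fintype V] {f g : ℝ → V → ℝ} {f' g' : V → ℝ}
    {t : ℝ} (hf : HasDerivAt f f' t) (hg : HasDerivAt g g' t) :
    HasDerivAt (fun t => f t ⬝ᵥ g t) (f' ⬝ᵥ g t + f t ⬝ᵥ g') t := by
  simp only [dotProduct, ← Finset.sum_add_distrib]
  exact HasDerivAt.fun_sum fun i _ => (hasDerivAt_pi.1 hf i).mul (hasDerivAt_pi.1 hg i)

theorem HasDerivAt.mulVec_const {V : Type*} [Fintype V] (A : Matrix V V ℝ) {f : ℝ → V → ℝ}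
    {f' : V → ℝ} {t : ℝ} (hf : HasDerivAt f f' t) :
    HasDerivAt (fun t => A *ᵥ f t) (A *ᵥ f') t :=
  ((Matrix.mulVecLin A).toContinuousLinearMap.hasFDerivAt.comp_hasDerivAt t hf)

theorem Matrix.IsSymm.dotProduct_mulVec_comm {V : Type*} [Fintype V] {A : Matrix V V ℝ}
    (hA : A.IsSymm) (x y : V → ℝ) : x ⬝ᵥ (A *ᵥ y) = (A *ᵥ x) ⬝ᵥ y := by
  rw [Matrix.dotProduct_mulVec, ← Matrix.mulVec_transpose, hA.eq]

theorem dotProduct_self_nonneg_real {V : Type*} [Fintype V] (x : V → ℝ) : 0 ≤ x ⬝ᵥ x :=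
  Finset.sum_nonneg fun i _ => mul_self_nonneg (x i)

/-- Young's inequality for the dot product. -/
theorem two_mul_dotProduct_le {V : Type*} [Fintype V] (x y : V → ℝ) :
    2 * (x ⬝ᵥ y) ≤ x ⬝ᵥ x + y ⬝ᵥ y := by
  have h := dotProduct_self_nonneg_real (x - y)
  simp only [sub_dotProduct, dotProduct_sub, dotProduct_comm y x] at h
  linarith

theorem two_mul_dotProduct_le_weighted {V : Type*} [Fintype V] (x y : V → ℝ) {c : ℝ} (hc : 0 < c) :
    2 * (x ⬝ᵥ y) ≤ c⁻¹ * (x ⬝ᵥ x) + c * (y ⬝ᵥ y) := by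
  have h := dotProduct_self_nonneg_real (x - c • y)
  simp only [sub_dotProduct, dotProduct_sub, dotProduct_comm y x, smul_dotProduct, dotProduct_smul,
    smul_eq_mul] at h
  have h2 : 0 ≤ c⁻¹ * (x ⬝ᵥ x - c * (x ⬝ᵥ y) - c * (x ⬝ᵥ y - c * (y ⬝ᵥ y))) :=
    mul_nonneg (by positivity) (by linarith)
  have h3 : c⁻¹ * (x ⬝ᵥ x - c * (x ⬝ᵥ y) - c * (x ⬝ᵥ y - c * (y ⬝ᵥ y)))
      = c⁻¹ * (x ⬝ᵥ x) + c * (y ⬝ᵥ y) - 2 * (x ⬝ᵥ y) := by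
    field_simp; ring
  linarith

theorem tendsto_zero_of_tendsto_dotProduct_self {V ι : Type*} [Fintype V] {l : Filter ι}
    {x : ι → V → ℝ} (h : Tendsto (fun t => x t ⬝ᵥ x t) l (𝓝 0)) : Tendsto x l (𝓝 0) := by
  rw [tendsto_pi_nhds]
  intro i
  have h1 := h.sqrt
  rw [Real.sqrt_zero] at h1
  refine squeeze_zero_norm (fun t => Real.abs_le_sqrt ?_) h1
  rw [sq]
  exact Finset.single_le_sum (f := fun i => x t i * x t i) (fun i _ => mul_self_nonneg _)
    (Finset.mem_univ i)

/-! ### The Laplacian and the discrete Poincaré inequality -/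

namespace SimpleGraph

variable {V : Type*} [Fintype V] [DecidableEq V] (G : SimpleGraph V) [DecidableRel G.Adj]

theorem dotProduct_lapMatrix_mulVec_self (x : V → ℝ) :
    x ⬝ᵥ (G.lapMatrix ℝ *ᵥ x) = (∑ i, ∑ j, if G.Adj i j then (x i - x j) ^ 2 else 0) / 2 := by
  rw [← lapMatrix_toLinearMap₂', Matrix.toLinearMap₂'_apply']

theorem sum_lapMatrix_mulVec (x : V → ℝ) : ∑ i, (G.lapMatrix ℝ *ᵥ x) i = 0 := by
  have h : (fun _ : V => (1 : ℝ)) ⬝ᵥ (G.lapMatrix ℝ *ᵥ x) = 0 := by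
    rw [(G.isSymm_lapMatrix (R := ℝ)).dotProduct_mulVec_comm, G.lapMatrix_mulVec_const_eq_zero,
      zero_dotProduct]
  simpa [dotProduct] using h

/-- The discrete Poincaré inequality on a connected graph. -/
theorem Connected.exists_poincare {G : SimpleGraph V} [DecidableRel G.Adj] (hG : G.Connected) :
    ∃ C : ℝ, 1 ≤ C ∧ ∀ x : V → ℝ, ∑ i, x i = 0 → x ⬝ᵥ x ≤ C * (x ⬝ᵥ (G.lapMatrix ℝ *ᵥ x)) := by
  -- On a connected graph the edge differences together with the coordinate sum determine `x`. An
  -- injective linear map on a finite-dimensional space is bounded below, and this yields the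
  -- constant.
  let f : (V → ℝ) →ₗ[ℝ] (V × V → ℝ) × ℝ :=
    { toFun := fun x => (fun e => if G.Adj e.1 e.2 then x e.1 - x e.2 else 0, ∑ i, x i)
      map_add' := fun x y => by
        ext e
        · simp only [Pi.add_apply, Prod.mk_add_mk]
          split_ifs <;> ring
        · simp [Finset.sum_add_distrib]
      map_smul' := fun c x => by
        ext e
        · simp only [Pi.smul_apply, smul_eq_mul, RingHom.id_apply, Prod.smul_mk]
          split_ifs <;> ring
        · simp [Finset.mul_sum] }
  have hf : Function.Injective f := by
    rw [injective_iff_map_eq_zero]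
    intro x hx
    have h1 : ∀ e : V × V, (if G.Adj e.1 e.2 then x e.1 - x e.2 else 0) = 0 :=
      fun e => congrFun (congrArg Prod.fst hx) e
    have h2 : ∑ i, x i = 0 := congrArg Prod.snd hx
    have h3 : G.lapMatrix ℝ *ᵥ x = 0 := by
      rw [lapMatrix_mulVec_eq_zero_iff_forall_adj]
      intro i j hij
      have := h1 (i, j)
      simp only [hij, if_true] at this
      linarith
    rw [lapMatrix_mulVec_eq_zero_iff_forall_reachable] at h3
    funext i
    have h4 : ∀ j, x j = x i := fun j => h3 j i (hG.preconnected j i)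
    simp only [h4, Finset.sum_const, nsmul_eq_mul] at h2
    have : Nonempty V := ⟨i⟩
    simpa using h2
  obtain ⟨K, hK, hfK⟩ := f.injective_iff_antilipschitz.1 hf
  -- Each coordinate satisfies `x i ^ 2 ≤ K ^ 2 * (2 * b)`, and there are `card V` of them. The
  -- maximum with 1 only serves later, to keep the decay rate small.
  refine ⟨max 1 (Fintype.card V * (K : ℝ) ^ 2 * 2), le_max_left _ _, fun x hx => ?_⟩
  set b := x ⬝ᵥ (G.lapMatrix ℝ *ᵥ x) with hb
  have hb' := G.dotProduct_lapMatrix_mulVec_self x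
  rw [← hb] at hb'
  have hb0 : 0 ≤ b := by
    rw [hb']
    positivity
  have hfx : ‖f x‖ ≤ √(2 * b) := by
    rw [Prod.norm_def]
    refine max_le ?_ ?_
    · rw [pi_norm_le_iff_of_nonneg (Real.sqrt_nonneg _)]
      rintro ⟨i, j⟩
      refine Real.abs_le_sqrt ?_
      have h5 : ((f x).1 (i, j)) ^ 2 = if G.Adj i j then (x i - x j) ^ 2 else 0 := by
        change (if G.Adj i j then x i - x j else 0) ^ 2 = _
        split_ifs <;> simp
      rw [h5, hb']
      have h6 : (if G.Adj i j then (x i - x j) ^ 2 else 0)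
          ≤ ∑ j, if G.Adj i j then (x i - x j) ^ 2 else 0 :=
        Finset.single_le_sum (f := fun j => if G.Adj i j then (x i - x j) ^ 2 else 0)
          (fun _ _ => by positivity) (Finset.mem_univ j)
      have h7 : (∑ j, if G.Adj i j then (x i - x j) ^ 2 else 0)
          ≤ ∑ i, ∑ j, if G.Adj i j then (x i - x j) ^ 2 else 0 :=
        Finset.single_le_sum (f := fun i => ∑ j, if G.Adj i j then (x i - x j) ^ 2 else 0)
          (fun _ _ => by positivity) (Finset.mem_univ i)
      linarith
    · have h8 : (f x).2 = 0 := hx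
      rw [h8, norm_zero]
      exact Real.sqrt_nonneg _
  have hxK : ‖x‖ ≤ K * √(2 * b) := by
    have := hfK.le_mul_norm_sub x 0
    rw [map_zero, add_zero, add_zero, norm_neg, norm_neg] at this
    exact this.trans (mul_le_mul_of_nonneg_left hfx K.2)
  have hxi : ∀ i, x i * x i ≤ K ^ 2 * (2 * b) := fun i => by
    have h9 : |x i| ≤ K * √(2 * b) := (norm_le_pi_norm x i).trans hxK
    rw [← abs_mul_abs_self]
    calc |x i| * |x i| ≤ (K * √(2 * b)) * (K * √(2 * b)) :=
          mul_self_le_mul_self (abs_nonneg _) h9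
      _ = K ^ 2 * (√(2 * b) * √(2 * b)) := by ring
      _ = _ := by rw [Real.mul_self_sqrt (by positivity)]
  calc x ⬝ᵥ x ≤ ∑ _i : V, (K : ℝ) ^ 2 * (2 * b) := Finset.sum_le_sum fun i _ => hxi i
    _ = (Fintype.card V * (K : ℝ) ^ 2 * 2) * b := by
      rw [Finset.sum_const, Finset.card_univ, nsmul_eq_mul]; ring
    _ ≤ _ := mul_le_mul_of_nonneg_right (le_max_right _ _) hb0

end SimpleGraph

/-! ### The adjoint flow and its energy decay -/

/-- Solutions of `r' = - A s`, `s' = r - A s`. -/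
structure IsAdjointFlow {V : Type*} [Fintype V] (A : Matrix V V ℝ) (r s : ℝ → V → ℝ) : Prop where
  hasDerivAt_fst : ∀ t, HasDerivAt r (-(A *ᵥ s t)) t
  hasDerivAt_snd : ∀ t, HasDerivAt s (r t - A *ᵥ s t) t

theorem exists_isAdjointFlow {V : Type*} [Fintype V] (A : Matrix V V ℝ) (v : V → ℝ) :
    ∃ r s : ℝ → V → ℝ, IsAdjointFlow A r s ∧ r 0 = v ∧ s 0 = 0 := by
  let T : ((V → ℝ) × (V → ℝ)) →L[ℝ] ((V → ℝ) × (V → ℝ)) := LinearMap.toContinuousLinearMap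
    ((-(Matrix.mulVecLin A ∘ₗ LinearMap.snd ℝ _ _)).prod
      (LinearMap.fst ℝ _ _ - Matrix.mulVecLin A ∘ₗ LinearMap.snd ℝ _ _))
  have hT : ∀ z, T z = (-(A *ᵥ z.2), z.1 - A *ᵥ z.2) := fun z => rfl
  let u : ℝ → (V → ℝ) × (V → ℝ) := fun t => NormedSpace.exp (t • T) (v, 0)
  have hu : ∀ t, HasDerivAt u (T (u t)) t := fun t => by
    have h := (hasDerivAt_exp_smul_const' (𝕂 := ℝ) T t).clm_apply
      (hasDerivAt_const t ((v, 0) : (V → ℝ) × (V → ℝ)))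
    simpa using h
  have h0 : u 0 = (v, 0) := by simp [u]
  refine ⟨fun t => (u t).1, fun t => (u t).2, ⟨fun t => ?_, fun t => ?_⟩, ?_, ?_⟩
  · exact hasFDerivAt_fst.comp_hasDerivAt t (hu t)
  · exact hasFDerivAt_snd.comp_hasDerivAt t (hu t)
  · simp [h0]
  · simp [h0]

namespace IsAdjointFlow

variable {V : Type*} [Fintype V] {A : Matrix V V ℝ} {r s : ℝ → V → ℝ}

/-- The terms in `r ⬝ᵥ (A *ᵥ s)` cancel by symmetry of `A`. What is left is the integrand of the
Wiener isometry up to the factor `-2`, so the noise variance integrates in closed form. -/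
theorem hasDerivAt_energy (h : IsAdjointFlow A r s) (hA : A.IsSymm) (t : ℝ) :
    HasDerivAt (fun t => r t ⬝ᵥ r t + s t ⬝ᵥ (A *ᵥ s t)) (-2 * ((A *ᵥ s t) ⬝ᵥ (A *ᵥ s t))) t := by
  have h1 := ((h.hasDerivAt_fst t).dotProduct_vec (h.hasDerivAt_fst t)).add
    ((h.hasDerivAt_snd t).dotProduct_vec ((h.hasDerivAt_snd t).mulVec_const A))
  refine h1.congr_deriv ?_
  simp only [hA.dotProduct_mulVec_comm (s t), Matrix.mulVec_sub, dotProduct_sub, sub_dotProduct,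
    neg_dotProduct, dotProduct_neg, dotProduct_comm (A *ᵥ s t) (r t)]
  ring

/-- The range of the Laplacian has zero sum, so the flow never leaves the zero-sum subspace, where
the Poincaré inequality applies. -/
theorem sum_snd_eq_zero {G : SimpleGraph V} [DecidableEq V] [DecidableRel G.Adj]
    (h : IsAdjointFlow (G.lapMatrix ℝ) r s) (h0 : ∑ i, r 0 i = 0) (h0' : ∑ i, s 0 i = 0) (t : ℝ) :
    ∑ i, s t i = 0 := by
  have h1 : ∀ t, HasDerivAt (fun t => ∑ i, r t i) 0 t := fun t => by
    have := HasDerivAt.fun_sum (u := Finset.univ)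
      fun i _ => hasDerivAt_pi.1 (h.hasDerivAt_fst t) i
    simpa [G.sum_lapMatrix_mulVec] using this
  have h2 : ∀ t, ∑ i, r t i = 0 := fun t =>
    (is_const_of_deriv_eq_zero (fun x => (h1 x).differentiableAt) (fun x => (h1 x).deriv) t 0).trans
      h0
  have h3 : ∀ t, HasDerivAt (fun t => ∑ i, s t i) 0 t := fun t => by
    have := HasDerivAt.fun_sum (u := Finset.univ)
      fun i _ => hasDerivAt_pi.1 (h.hasDerivAt_snd t) i
    simpa [G.sum_lapMatrix_mulVec, h2] using this
  exact (is_const_of_deriv_eq_zero (fun x => (h3 x).differentiableAt)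
    (fun x => (h3 x).deriv) t 0).trans h0'

/-- Exponential decay of the energy of the adjoint flow on a connected graph. -/
theorem tendsto_energy {G : SimpleGraph V} [DecidableEq V] [DecidableRel G.Adj]
    (h : IsAdjointFlow (G.lapMatrix ℝ) r s) (hG : G.Connected)
    (h0 : ∑ i, r 0 i = 0) (h0' : ∑ i, s 0 i = 0) :
    Tendsto (fun t => r t ⬝ᵥ r t + s t ⬝ᵥ (G.lapMatrix ℝ *ᵥ s t)) atTop (𝓝 0) := by
  have hA := G.isSymm_lapMatrix (R := ℝ)
  obtain ⟨C, hC1, hC⟩ := hG.exists_poincare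
  have hC0 : 0 < C := by linarith
  set ε : ℝ := 1 / (4 * C) with hε
  have hε0 : 0 < ε := by positivity
  have hεC : ε * C = 1 / 4 := by rw [hε]; field_simp
  have hε1 : ε ≤ 1 / 4 := by nlinarith
  -- The energy dissipates only through `A *ᵥ s` and not directly through `r`. The small cross term
  -- contributes `-2 * ε * (r ⬝ᵥ r)` to the derivative, and `ε * C = 1 / 4` keeps `F` within a
  -- factor 2 of the energy.
  set F : ℝ → ℝ := fun t =>
    r t ⬝ᵥ r t + s t ⬝ᵥ (G.lapMatrix ℝ *ᵥ s t) - 2 * ε * (r t ⬝ᵥ s t) with hF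
  have ha : ∀ t, 0 ≤ r t ⬝ᵥ r t := fun t => dotProduct_self_nonneg_real _
  have hb : ∀ t, 0 ≤ s t ⬝ᵥ (G.lapMatrix ℝ *ᵥ s t) := fun t => by
    rw [G.dotProduct_lapMatrix_mulVec_self]; positivity
  have hsb : ∀ t, s t ⬝ᵥ s t ≤ C * (s t ⬝ᵥ (G.lapMatrix ℝ *ᵥ s t)) := fun t =>
    hC _ (h.sum_snd_eq_zero h0 h0' t)
  -- Young with weight `C` gives `2 * b ≤ C⁻¹ * (s ⬝ᵥ s) + C * c`, and Poincaré absorbs the first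
  -- term into one `b`.
  have hbc : ∀ t, s t ⬝ᵥ (G.lapMatrix ℝ *ᵥ s t)
      ≤ C * ((G.lapMatrix ℝ *ᵥ s t) ⬝ᵥ (G.lapMatrix ℝ *ᵥ s t)) := fun t => by
    have h1 := two_mul_dotProduct_le_weighted (s t) (G.lapMatrix ℝ *ᵥ s t) hC0
    have h2 : C⁻¹ * (s t ⬝ᵥ s t) ≤ s t ⬝ᵥ (G.lapMatrix ℝ *ᵥ s t) := by
      rw [inv_mul_le_iff₀ hC0]; exact hsb t
    linarith
  have hm : ∀ t, 2 * ε * |r t ⬝ᵥ s t|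
      ≤ (r t ⬝ᵥ r t + s t ⬝ᵥ (G.lapMatrix ℝ *ᵥ s t)) / 2 := fun t => by
    have h1 := two_mul_dotProduct_le (r t) (s t)
    have h2 := two_mul_dotProduct_le (-r t) (s t)
    simp only [neg_dotProduct, dotProduct_neg, neg_neg] at h2
    have h3 : 2 * |r t ⬝ᵥ s t| ≤ r t ⬝ᵥ r t + C * (s t ⬝ᵥ (G.lapMatrix ℝ *ᵥ s t)) := by
      rcases abs_cases (r t ⬝ᵥ s t) with h4 | h4 <;> linarith [h4.1, hsb t]
    have h5 := mul_le_mul_of_nonneg_left h3 hε0.le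
    have h6 : ε * (r t ⬝ᵥ r t) ≤ 1 / 4 * (r t ⬝ᵥ r t) := mul_le_mul_of_nonneg_right hε1 (ha t)
    have h7 : ε * (C * (s t ⬝ᵥ (G.lapMatrix ℝ *ᵥ s t)))
        = 1 / 4 * (s t ⬝ᵥ (G.lapMatrix ℝ *ᵥ s t)) := by rw [← mul_assoc, hεC]
    have := hb t
    have := ha t
    nlinarith
  have hFlow : ∀ t, r t ⬝ᵥ r t + s t ⬝ᵥ (G.lapMatrix ℝ *ᵥ s t) ≤ 2 * F t := fun t => by
    have h1 := mul_le_mul_of_nonneg_left (le_abs_self (r t ⬝ᵥ s t)) (by positivity : 0 ≤ 2 * ε)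
    have := hm t
    simp only [hF]
    linarith
  have hFup : ∀ t, F t ≤ 2 * (r t ⬝ᵥ r t + s t ⬝ᵥ (G.lapMatrix ℝ *ᵥ s t)) := fun t => by
    have h1 := mul_le_mul_of_nonneg_left (neg_abs_le (r t ⬝ᵥ s t)) (by positivity : 0 ≤ 2 * ε)
    have := hm t
    have := ha t
    have := hb t
    simp only [hF]
    linarith
  -- With `a, b, c, k` as named below, the derivative is `-2c + 2ε(b - a + k)`. Using `2k ≤ a + c`,
  -- `εb ≤ c/4` and `ε ≤ 1/4`, it is at most `-ε(a + b)`, hence at most `-(ε/2) F`.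
  have hF' : ∀ t, ∃ d, HasDerivAt F d t ∧ d ≤ -(ε / 2) * F t := fun t => by
    refine ⟨_, (h.hasDerivAt_energy hA t).sub (((h.hasDerivAt_fst t).dotProduct_vec
      (h.hasDerivAt_snd t)).const_mul (2 * ε)), ?_⟩
    have h1 := two_mul_dotProduct_le (r t) (G.lapMatrix ℝ *ᵥ s t)
    rw [neg_dotProduct, dotProduct_comm _ (s t), dotProduct_sub]
    have hc0 := dotProduct_self_nonneg_real (G.lapMatrix ℝ *ᵥ s t)
    have h2 := hFup t
    have h3 := hbc t
    generalize r t ⬝ᵥ r t = a at *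
    generalize s t ⬝ᵥ (G.lapMatrix ℝ *ᵥ s t) = b at *
    generalize (G.lapMatrix ℝ *ᵥ s t) ⬝ᵥ (G.lapMatrix ℝ *ᵥ s t) = c at *
    generalize r t ⬝ᵥ (G.lapMatrix ℝ *ᵥ s t) = k at *
    have h4 := mul_le_mul_of_nonneg_left h1 hε0.le
    have h5 := mul_le_mul_of_nonneg_left h2 hε0.le
    have h6 := mul_le_mul_of_nonneg_left h3 hε0.le
    rw [← mul_assoc, hεC] at h6
    have h7 : ε * c ≤ 1 / 4 * c := mul_le_mul_of_nonneg_right hε1 hc0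
    nlinarith
  have hanti : Antitone fun t => F t * Real.exp (ε / 2 * t) := by
    choose d hd hd' using hF'
    have hder : ∀ t, HasDerivAt (fun t => F t * Real.exp (ε / 2 * t))
        (d t * Real.exp (ε / 2 * t) + F t * (Real.exp (ε / 2 * t) * (ε / 2))) t := fun t =>
      (hd t).mul (((hasDerivAt_id t).const_mul (ε / 2)).exp.congr_deriv (by simp))
    refine antitone_of_deriv_nonpos (fun t => (hder t).differentiableAt) fun t => ?_
    rw [(hder t).deriv]
    have := mul_le_mul_of_nonneg_right (hd' t) (Real.exp_pos (ε / 2 * t)).le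
    linarith
  have hbound : ∀ t, 0 ≤ t → r t ⬝ᵥ r t + s t ⬝ᵥ (G.lapMatrix ℝ *ᵥ s t)
      ≤ 2 * F 0 * Real.exp (-(ε / 2 * t)) := fun t ht => by
    have h1 : F t * Real.exp (ε / 2 * t) ≤ F 0 := by simpa using hanti ht
    have h2 : F t ≤ F 0 * Real.exp (-(ε / 2 * t)) := by
      rw [Real.exp_neg, ← div_eq_mul_inv, le_div_iff₀ (Real.exp_pos _)]
      exact h1
    linarith [hFlow t]
  have hlim : Tendsto (fun t => 2 * F 0 * Real.exp (-(ε / 2 * t))) atTop (𝓝 0) := by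
    have := (Real.tendsto_exp_neg_atTop_nhds_zero.comp
      (tendsto_id.const_mul_atTop (by positivity : 0 < ε / 2))).const_mul (2 * F 0)
    simpa [Function.comp_def] using this
  refine tendsto_of_tendsto_of_tendsto_of_le_of_le' tendsto_const_nhds hlim
    (Eventually.of_forall fun t => add_nonneg (ha t) (hb t)) ?_
  filter_upwards [eventually_ge_atTop 0] with t ht using hbound t ht

theorem tendsto_fst {G : SimpleGraph V} [DecidableEq V] [DecidableRel G.Adj]
    (h : IsAdjointFlow (G.lapMatrix ℝ) r s) (hG : G.Connected)
    (h0 : ∑ i, r 0 i = 0) (h0' : ∑ i, s 0 i = 0) : Tendsto r atTop (𝓝 0) := by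
  refine tendsto_zero_of_tendsto_dotProduct_self (squeeze_zero
    (fun t => dotProduct_self_nonneg_real _) (fun t => ?_) (h.tendsto_energy hG h0 h0'))
  have : 0 ≤ s t ⬝ᵥ (G.lapMatrix ℝ *ᵥ s t) := by
    rw [G.dotProduct_lapMatrix_mulVec_self]; positivity
  linarith

theorem tendsto_snd {G : SimpleGraph V} [DecidableEq V] [DecidableRel G.Adj]
    (h : IsAdjointFlow (G.lapMatrix ℝ) r s) (hG : G.Connected)
    (h0 : ∑ i, r 0 i = 0) (h0' : ∑ i, s 0 i = 0) : Tendsto s atTop (𝓝 0) := by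
  obtain ⟨C, hC1, hC⟩ := hG.exists_poincare
  have h1 := (h.tendsto_energy hG h0 h0').const_mul C
  rw [mul_zero] at h1
  refine tendsto_zero_of_tendsto_dotProduct_self (squeeze_zero
    (fun t => dotProduct_self_nonneg_real _) (fun t => ?_) h1)
  -- The energy controls only `s ⬝ᵥ (A *ᵥ s)`; Poincaré upgrades this to `s` itself.
  have h2 := hC _ (h.sum_snd_eq_zero h0 h0' t)
  have h3 := mul_nonneg (zero_le_one.trans hC1) (dotProduct_self_nonneg_real (r t))
  linarith

end IsAdjointFlow

/-- The scalar Wiener isometry, with `min u v` the Brownian covariance. With `R` the primitive of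
`Q`, splitting the inner integral at `v = u` reduces it to `g u * R u`; then `(-Q R)' = g R - Q²`,
and the boundary terms vanish because `R 0 = 0` and `Q t = 0`. -/
theorem integral_integral_mul_min {g Q : ℝ → ℝ} (hg : Continuous g)
    (hQ : ∀ u, HasDerivAt Q (-g u) u) {t : ℝ} (ht : 0 ≤ t) (hQt : Q t = 0) :
    ∫ u in (0 : ℝ)..t, ∫ v in (0 : ℝ)..t, g u * g v * min u v = ∫ u in (0 : ℝ)..t, Q u * Q u := by
  have hQc : Continuous Q := continuous_iff_continuousAt.2 fun u => (hQ u).continuousAt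
  set R : ℝ → ℝ := fun s => ∫ u in (0 : ℝ)..s, Q u with hR
  have hR' : ∀ s, HasDerivAt R (Q s) s := fun s => hQc.integral_hasStrictDerivAt 0 s |>.hasDerivAt
  have hRc : Continuous R := continuous_iff_continuousAt.2 fun u => (hR' u).continuousAt
  have hR0 : R 0 = 0 := intervalIntegral.integral_same
  have h1 : ∀ u ∈ Set.uIcc 0 t, ∫ v in (0 : ℝ)..t, g u * g v * min u v = g u * R u := by
    intro u hu
    rw [Set.uIcc_of_le ht] at hu
    have hA : ∫ v in (0 : ℝ)..u, g u * g v * min u v = g u * (-Q u * u + R u) := by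
      have h2 : ∫ v in (0 : ℝ)..u, g u * g v * min u v = ∫ v in (0 : ℝ)..u, g u * (g v * v) := by
        refine intervalIntegral.integral_congr fun v hv => ?_
        rw [Set.uIcc_of_le hu.1] at hv
        simp only [min_eq_right hv.2]
        ring
      rw [h2, intervalIntegral.integral_eq_sub_of_hasDerivAt
        (f := fun v => g u * (-Q v * v + R v)) (fun v _ => ?_)
        ((by fun_prop : Continuous fun v => g u * (g v * v)).intervalIntegrable _ _)]
      · simp [hR0]
      · refine ((((hQ v).neg.mul (hasDerivAt_id v)).add (hR' v)).const_mul (g u)).congr_deriv ?_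
        simp only [id, Pi.neg_apply]
        ring
    have hB : ∫ v in u..t, g u * g v * min u v = g u * (Q u * u) := by
      have h2 : ∫ v in u..t, g u * g v * min u v = ∫ v in u..t, g u * (g v * u) := by
        refine intervalIntegral.integral_congr fun v hv => ?_
        rw [Set.uIcc_of_le hu.2] at hv
        simp only [min_eq_left hv.1]
        ring
      rw [h2, intervalIntegral.integral_eq_sub_of_hasDerivAt
        (f := fun v => g u * (-Q v * u)) (fun v _ => ?_)
        ((by fun_prop : Continuous fun v => g u * (g v * u)).intervalIntegrable _ _)]
      · simp [hQt]
      · refine (((hQ v).neg.mul_const u).const_mul (g u)).congr_deriv ?_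
        ring
    have hc : Continuous fun v => g u * g v * min u v := by fun_prop
    rw [← intervalIntegral.integral_add_adjacent_intervals (hc.intervalIntegrable 0 u)
      (hc.intervalIntegrable u t), hA, hB]
    ring
  rw [intervalIntegral.integral_congr h1, ← sub_eq_zero,
    ← intervalIntegral.integral_sub ((by fun_prop : Continuous fun u => g u * R u).intervalIntegrable _ _)
      ((by fun_prop : Continuous fun u => Q u * Q u).intervalIntegrable _ _),
    intervalIntegral.integral_eq_sub_of_hasDerivAt (f := fun v => -Q v * R v) (fun v _ => ?_)
        ((by fun_prop : Continuous fun u => g u * R u - Q u * Q u).intervalIntegrable _ _)]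
  · simp [hR0, hQt]
  · refine ((hQ v).neg.mul (hR' v)).congr_deriv ?_
    simp only [Pi.neg_apply]
    ring

/-! ### Joint measurability and mean-square convergence -/

section Probability

variable {Ω : Type*} [MeasurableSpace Ω] {P : Measure Ω}

/-- A process with almost surely continuous paths is jointly measurable up to a null set. -/
theorem aestronglyMeasurable_uncurry_of_continuous [SFinite P] {X : ℝ≥0 → Ω → ℝ}
    (hX : ∀ t, AEMeasurable (X t) P) (hc : ∀ᵐ ω ∂P, Continuous fun t => X t ω) (ν : Measure ℝ)
    [SFinite ν] :
    AEStronglyMeasurable (fun z : ℝ × Ω => X z.1.toNNReal z.2) (ν.prod P) := by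
  -- Time is sampled on the grid of mesh `1 / n`. Each approximation uses countably many random
  -- variables, so it can be built from measurable versions, and path continuity gives the limit.
  let τ : ℕ → ℕ → ℝ≥0 := fun n k => ((k : ℝ) / n).toNNReal
  let a : ℕ → ℝ × Ω → ℝ := fun n z => (hX (τ n ⌊max z.1 0 * n⌋₊)).mk _ z.2
  refine aestronglyMeasurable_of_tendsto_ae (u := atTop) (f := a) (fun n => ?_) ?_
  · have h1 : Measurable fun p : ℕ × Ω => (hX (τ n p.1)).mk _ p.2 :=
      measurable_from_prod_countable_right fun k => (hX (τ n k)).measurable_mk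
    have h2 : Measurable fun z : ℝ × Ω => (⌊max z.1 0 * n⌋₊, z.2) :=
      (Nat.measurable_floor.comp ((measurable_fst.max measurable_const).mul_const _)).prodMk
        measurable_snd
    exact (h1.comp h2).aestronglyMeasurable
  · have h3 : ∀ᵐ ω ∂P, ∀ n k, X (τ n k) ω = (hX (τ n k)).mk _ ω :=
      ae_all_iff.2 fun n => ae_all_iff.2 fun k => (hX _).ae_eq_mk
    have h4 := (Measure.quasiMeasurePreserving_snd (μ := ν) (ν := P)).ae (h3.and hc)
    filter_upwards [h4] with z hz
    have h5 : Tendsto (fun n : ℕ => τ n ⌊max z.1 0 * n⌋₊) atTop (𝓝 z.1.toNNReal) := by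
      have h6 : Tendsto (fun n : ℕ => ((⌊max z.1 0 * n⌋₊ : ℝ) / n)) atTop (𝓝 (max z.1 0)) :=
        (tendsto_nat_floor_mul_div_atTop (le_max_right _ _)).comp tendsto_natCast_atTop_atTop
      have h7 := (continuous_real_toNNReal.tendsto (max z.1 0)).comp h6
      have h8 : (max z.1 0).toNNReal = z.1.toNNReal := by
        rcases le_total z.1 0 with h | h
        · simp [h, Real.toNNReal_of_nonpos h]
        · simp [h]
      rw [h8] at h7
      exact h7
    have h9 := (hz.2.tendsto z.1.toNNReal).comp h5
    refine h9.congr fun n => ?_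
    exact hz.1 n _

/-- The Cauchy–Schwarz inequality. -/
theorem sq_integral_mul_le {f g : Ω → ℝ} (hf : MemLp f 2 P) (hg : MemLp g 2 P) :
    (∫ ω, f ω * g ω ∂P) ^ 2 ≤ (∫ ω, f ω ^ 2 ∂P) * ∫ ω, g ω ^ 2 ∂P := by
  have hfg : Integrable (fun ω => f ω * g ω) P := hf.integrable_mul hg
  have h : ∀ x : ℝ, 0 ≤ (∫ ω, g ω ^ 2 ∂P) * (x * x) + (2 * ∫ ω, f ω * g ω ∂P) * x
      + ∫ ω, f ω ^ 2 ∂P := fun x => by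
    have h1 : ∫ ω, (f ω + x * g ω) ^ 2 ∂P = (∫ ω, g ω ^ 2 ∂P) * (x * x)
        + (2 * ∫ ω, f ω * g ω ∂P) * x + ∫ ω, f ω ^ 2 ∂P := by
      have h2 : ∀ ω, (f ω + x * g ω) ^ 2 = (x * x) * g ω ^ 2 + (2 * x) * (f ω * g ω) + f ω ^ 2 :=
        fun ω => by ring
      simp_rw [h2]
      rw [integral_add ((hg.integrable_sq.const_mul _).fun_add (hfg.const_mul _)) hf.integrable_sq,
        integral_add (hg.integrable_sq.const_mul _) (hfg.const_mul _), integral_const_mul,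
        integral_const_mul]
      ring
    rw [← h1]
    exact integral_nonneg fun ω => sq_nonneg _
  have h3 := discrim_le_zero h
  rw [discrim] at h3
  linarith

/-- A perturbation that vanishes in mean square does not change the limit of second moments. -/
theorem tendsto_integral_add_sq {ι : Type*} {l : Filter ι} {f g : ι → Ω → ℝ} {c : ℝ}
    (hf : ∀ i, MemLp (f i) 2 P) (hg : ∀ i, MemLp (g i) 2 P)
    (hf0 : Tendsto (fun i => ∫ ω, f i ω ^ 2 ∂P) l (𝓝 0))
    (hgc : Tendsto (fun i => ∫ ω, g i ω ^ 2 ∂P) l (𝓝 c)) :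
    Tendsto (fun i => ∫ ω, (f i ω + g i ω) ^ 2 ∂P) l (𝓝 c) := by
  have h1 : ∀ i, ∫ ω, (f i ω + g i ω) ^ 2 ∂P
      = (∫ ω, f i ω ^ 2 ∂P) + 2 * (∫ ω, f i ω * g i ω ∂P) + ∫ ω, g i ω ^ 2 ∂P := fun i => by
    have hfg : Integrable (fun ω => f i ω * g i ω) P := (hf i).integrable_mul (hg i)
    simp_rw [add_sq, mul_assoc]
    rw [integral_add ((hf i).integrable_sq.fun_add (hfg.const_mul _)) (hg i).integrable_sq,
      integral_add (hf i).integrable_sq (hfg.const_mul _), integral_const_mul]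
  have h2 : Tendsto (fun i => ∫ ω, f i ω * g i ω ∂P) l (𝓝 0) := by
    have h3 := (hf0.mul hgc).sqrt
    rw [zero_mul, Real.sqrt_zero] at h3
    exact squeeze_zero_norm (fun i => Real.abs_le_sqrt (sq_integral_mul_le (hf i) (hg i))) h3
  simp_rw [h1]
  simpa using (hf0.add (h2.const_mul 2)).add hgc

end Probability

/-! ### Brownian covariances and the Wiener isometry -/

namespace IsBrownianVector

variable {V Ω : Type*} [MeasurableSpace Ω] {P : Measure Ω} {W : ℝ≥0 → Ω → V → ℝ}

theorem memLp_two (hW : IsBrownianVector P W) (u : ℝ≥0) (j : V) :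
    MemLp (fun ω => W u ω j) 2 P :=
  ((hW.isBrownianReal j).hasLaw_eval u).hasGaussianLaw.memLp_two

theorem integral_mul [DecidableEq V] [IsProbabilityMeasure P] (hW : IsBrownianVector P W)
    (u v : ℝ≥0) (j k : V) :
    ∫ ω, W u ω j * W v ω k ∂P = if j = k then ((min u v : ℝ≥0) : ℝ) else 0 := by
  have h0 : ∀ u j, ∫ ω, W u ω j ∂P = 0 := fun u j => (hW.isBrownianReal j).integral_eval u
  split_ifs with hjk
  · subst hjk
    have h1 := (hW.isBrownianReal j).covariance_fun_eval u v
    rw [covariance_eq_sub (hW.memLp_two u j) (hW.memLp_two v j), h0, zero_mul, sub_zero] at h1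
    exact h1
  · have h1 : IndepFun (fun ω => W u ω j) (fun ω => W v ω k) P :=
      (hW.iIndepFun.indepFun hjk).comp (measurable_pi_apply u) (measurable_pi_apply v)
    have h2 := h1.integral_mul_eq_mul_integral (hW.memLp_two u j).aestronglyMeasurable
      (hW.memLp_two v k).aestronglyMeasurable
    rw [h0, zero_mul] at h2
    exact h2

variable [Fintype V]

theorem memLp_two_dotProduct (hW : IsBrownianVector P W) (u : ℝ≥0) (a : V → ℝ) :
    MemLp (fun ω => a ⬝ᵥ W u ω) 2 P :=
  memLp_finsetSum _ fun j _ => (hW.memLp_two u j).const_mul (a j)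

theorem integral_dotProduct_mul [IsProbabilityMeasure P]
    (hW : IsBrownianVector P W) (u v : ℝ≥0) (a b : V → ℝ) :
    ∫ ω, (a ⬝ᵥ W u ω) * (b ⬝ᵥ W v ω) ∂P = (a ⬝ᵥ b) * ((min u v : ℝ≥0) : ℝ) := by
  classical
  have hint : ∀ j k, Integrable (fun ω => a j * W u ω j * (b k * W v ω k)) P := fun j k =>
    ((hW.memLp_two u j).const_mul (a j)).integrable_mul ((hW.memLp_two v k).const_mul (b k))
  have h1 : ∀ j k, ∫ ω, a j * W u ω j * (b k * W v ω k) ∂P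
      = if j = k then a j * b k * ((min u v : ℝ≥0) : ℝ) else 0 := fun j k => by
    have h2 : ∀ ω, a j * W u ω j * (b k * W v ω k) = a j * b k * (W u ω j * W v ω k) :=
      fun ω => by ring
    simp_rw [h2]
    rw [integral_const_mul, hW.integral_mul]
    split_ifs <;> simp
  simp only [dotProduct, Finset.sum_mul_sum]
  rw [integral_finsetSum _ fun j _ => integrable_finsetSum _ fun k _ => hint j k]
  simp_rw [integral_finsetSum _ fun k _ => hint _ k, h1]
  simp [Finset.sum_mul]

/-- The Wiener integral `∫₀ᵗ Q · dW = ∫₀ᵗ g · W du` of a function `Q` with `Q' = -g` and `Q t = 0`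
is square integrable, and its second moment is `∫₀ᵗ |Q|² du`. -/
theorem wiener_isometry [IsProbabilityMeasure P] (hW : IsBrownianVector P W) {g Q : ℝ → V → ℝ}
    (hg : Continuous g) (hQ : ∀ u, HasDerivAt Q (-g u) u) {t : ℝ} (ht : 0 ≤ t) (hQt : Q t = 0) :
    MemLp (fun ω => ∫ u in (0 : ℝ)..t, g u ⬝ᵥ W u.toNNReal ω) 2 P ∧
      ∫ ω, (∫ u in (0 : ℝ)..t, g u ⬝ᵥ W u.toNNReal ω) ^ 2 ∂P = ∫ u in (0 : ℝ)..t, Q u ⬝ᵥ Q u := by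
  set μ : Measure ℝ := volume.restrict (Set.Ioc 0 t) with hμ
  set f : ℝ → Ω → ℝ := fun u ω => g u ⬝ᵥ W u.toNNReal ω with hf
  have hgj : ∀ j, Continuous fun u => g u j := fun j => (continuous_apply j).comp hg
  have hfm : AEStronglyMeasurable (fun z : ℝ × Ω => f z.1 z.2) (μ.prod P) := by
    refine Finset.aestronglyMeasurable_fun_sum _ fun j _ => ?_
    exact ((hgj j).measurable.comp measurable_fst).aestronglyMeasurable.mul
      (aestronglyMeasurable_uncurry_of_continuous
        (fun s => (hW.isBrownianReal j).aemeasurable s) (hW.isBrownianReal j).cont μ)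
  have hf2 : ∀ u, MemLp (f u) 2 P := fun u => hW.memLp_two_dotProduct _ _
  set c : ℝ → ℝ := fun u => (g u ⬝ᵥ g u) * u.toNNReal with hc
  have hcc : Continuous c :=
    (continuous_finsetSum _ fun j _ => (hgj j).mul (hgj j)).mul
      (NNReal.continuous_coe.comp continuous_real_toNNReal)
  have hcf : ∀ u, ∫ ω, f u ω ^ 2 ∂P = c u := fun u => by
    simp only [hf, sq, hW.integral_dotProduct_mul, min_self, hc]
  have hci : Integrable c μ := (hcc.integrableOn_Icc (a := 0) (b := t)).mono_set Set.Ioc_subset_Icc_self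
  have hFm : AEStronglyMeasurable (fun z : (ℝ × ℝ) × Ω => f z.1.1 z.2 * f z.1.2 z.2)
      ((μ.prod μ).prod P) := by
    have h1 : Measure.QuasiMeasurePreserving (fun z : (ℝ × ℝ) × Ω => (z.1.1, z.2))
        ((μ.prod μ).prod P) (μ.prod P) :=
      MeasureTheory.QuasiMeasurePreserving.prodMap Measure.quasiMeasurePreserving_fst
        (Measure.QuasiMeasurePreserving.id P)
    have h2 : Measure.QuasiMeasurePreserving (fun z : (ℝ × ℝ) × Ω => (z.1.2, z.2))
        ((μ.prod μ).prod P) (μ.prod P) :=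
      MeasureTheory.QuasiMeasurePreserving.prodMap Measure.quasiMeasurePreserving_snd
        (Measure.QuasiMeasurePreserving.id P)
    exact (hfm.comp_quasiMeasurePreserving h1).mul (hfm.comp_quasiMeasurePreserving h2)
  have hFi : Integrable (fun z : (ℝ × ℝ) × Ω => f z.1.1 z.2 * f z.1.2 z.2)
      ((μ.prod μ).prod P) := by
    rw [integrable_prod_iff hFm]
    refine ⟨ae_of_all _ fun z => (hf2 z.1).integrable_mul (hf2 z.2), ?_⟩
    -- The bound `|f u * f v| ≤ f u ^ 2 + f v ^ 2` dominates the expectation by `c u + c v`, which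
    -- is integrable on the square. This justifies Fubini.
    refine Integrable.mono' (g := fun z => c z.1 + c z.2)
      ((hci.comp_fst μ).add (hci.comp_snd μ)) hFm.norm.integral_prod_right' (ae_of_all _ fun z => ?_)
    rw [Real.norm_of_nonneg (integral_nonneg fun ω => norm_nonneg _)]
    simp only
    rw [← hcf, ← hcf, ← integral_add (hf2 _).integrable_sq (hf2 _).integrable_sq]
    refine integral_mono ((hf2 _).integrable_mul (hf2 _)).norm
      ((hf2 _).integrable_sq.add (hf2 _).integrable_sq) fun ω => ?_
    simp only [Real.norm_eq_abs, abs_mul]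
    nlinarith [sq_nonneg (|f z.1 ω| - |f z.2 ω|), sq_abs (f z.1 ω), sq_abs (f z.2 ω),
      sq_nonneg (f z.1 ω), sq_nonneg (f z.2 ω)]
  have hZ : ∀ ω, ∫ u in (0 : ℝ)..t, f u ω = ∫ u, f u ω ∂μ := fun ω =>
    intervalIntegral.integral_of_le ht
  have hZ2 : ∀ ω, (∫ u in (0 : ℝ)..t, f u ω) ^ 2 = ∫ z : ℝ × ℝ, f z.1 ω * f z.2 ω ∂(μ.prod μ) :=
    fun ω => by rw [hZ, integral_prod_mul (fun u => f u ω) (fun u => f u ω), sq]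
  have hZm : AEStronglyMeasurable (fun ω => ∫ u in (0 : ℝ)..t, f u ω) P := by
    simp_rw [hZ]
    exact hfm.prod_swap.integral_prod_right'
  refine ⟨(memLp_two_iff_integrable_sq hZm).2 ?_, ?_⟩
  · simp_rw [hZ2]
    exact hFi.integral_prod_right
  · have hK : ∀ z : ℝ × ℝ, ∫ ω, f z.1 ω * f z.2 ω ∂P
        = (g z.1 ⬝ᵥ g z.2) * ((min z.1.toNNReal z.2.toNNReal : ℝ≥0) : ℝ) := fun z =>
      hW.integral_dotProduct_mul _ _ _ _
    have hKi : Integrable (fun z : ℝ × ℝ => (g z.1 ⬝ᵥ g z.2) *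
        ((min z.1.toNNReal z.2.toNNReal : ℝ≥0) : ℝ)) (μ.prod μ) :=
      hFi.integral_prod_left.congr (ae_of_all _ hK)
    change ∫ ω, (∫ u in (0 : ℝ)..t, f u ω) ^ 2 ∂P = _
    simp_rw [hZ2]
    rw [integral_integral_swap (f := fun ω (z : ℝ × ℝ) => f z.1 ω * f z.2 ω) hFi.swap]
    rw [integral_congr_ae (ae_of_all _ hK), integral_prod _ hKi]
    simp only [hμ]
    rw [← intervalIntegral.integral_of_le ht]
    have hcont : ∀ j, Continuous (Function.uncurry fun u v : ℝ => g u j * g v j * min u v) :=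
      fun j => (((hgj j).comp continuous_fst).mul ((hgj j).comp continuous_snd)).mul
        (continuous_fst.min continuous_snd)
    have hinner : ∀ u ∈ Set.uIcc 0 t, ∫ v in Set.Ioc 0 t,
        (g u ⬝ᵥ g v) * ((min u.toNNReal v.toNNReal : ℝ≥0) : ℝ)
        = ∑ j, ∫ v in (0 : ℝ)..t, g u j * g v j * min u v := fun u hu => by
      rw [Set.uIcc_of_le ht] at hu
      have hint : ∀ j ∈ Finset.univ, IntervalIntegrable (fun v => g u j * g v j * min u v)
          volume 0 t := fun j _ =>
        ((hcont j).comp (Continuous.prodMk_right u)).intervalIntegrable 0 t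
      rw [← intervalIntegral.integral_finsetSum hint,
        ← intervalIntegral.integral_of_le ht]
      refine intervalIntegral.integral_congr fun v hv => ?_
      rw [Set.uIcc_of_le ht] at hv
      simp only [dotProduct, NNReal.coe_min, Real.coe_toNNReal _ hu.1, Real.coe_toNNReal _ hv.1,
        Finset.sum_mul]
    rw [intervalIntegral.integral_congr hinner, intervalIntegral.integral_finsetSum fun j _ =>
      (intervalIntegral.continuous_parametric_intervalIntegral_of_continuous' (hcont j) 0 t
        ).intervalIntegrable 0 t]
    have hQj : ∀ j u, HasDerivAt (fun u => Q u j) (-g u j) u := fun j u => hasDerivAt_pi.1 (hQ u) j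
    have hQjc : ∀ j, Continuous fun u => Q u j := fun j =>
      continuous_iff_continuousAt.2 fun u => (hQj j u).continuousAt
    simp only [dotProduct]
    have hint : ∀ j ∈ Finset.univ, IntervalIntegrable (fun u => Q u j * Q u j) volume 0 t :=
      fun j _ => ((hQjc j).mul (hQjc j)).intervalIntegrable 0 t
    rw [intervalIntegral.integral_finsetSum hint]
    exact Finset.sum_congr rfl fun j _ =>
      integral_integral_mul_min (hgj j) (hQj j) ht (by rw [hQt]; rfl)

end IsBrownianVector

/-! ### Variation of parameters and the limiting second moment -/

/-- Variation of parameters: the solution of the integral equations, tested against the adjoint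
flow. -/
theorem IsAdjointFlow.variation_of_parameters {V : Type*} [Fintype V] {A : Matrix V V ℝ}
    {r s : ℝ → V → ℝ} (h : IsAdjointFlow A r s) (hA : A.IsSymm) (hs0 : s 0 = 0)
    {X₁ X₂ B : ℝ → V → ℝ} (hX₁ : Continuous X₁) (hX₂ : Continuous X₂) (hB : Continuous B)
    (h₁ : ∀ u, 0 ≤ u → ∀ j, X₁ u j = X₁ 0 j + ∫ v in (0 : ℝ)..u, X₂ v j)
    (h₂ : ∀ u, 0 ≤ u → ∀ j, X₂ u j = X₂ 0 j
      + (∫ v in (0 : ℝ)..u, (-(A *ᵥ X₁ v) j - (A *ᵥ X₂ v) j)) + B u j)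
    {t : ℝ} (ht : 0 ≤ t) :
    (A *ᵥ r 0) ⬝ᵥ X₁ t = (A *ᵥ r t) ⬝ᵥ X₁ 0 + ((A *ᵥ s t) ⬝ᵥ X₂ 0
      + ∫ u in (0 : ℝ)..t, (A *ᵥ (r (t - u) - A *ᵥ s (t - u))) ⬝ᵥ B u) := by
  have hAc : ∀ {X : ℝ → V → ℝ}, Continuous X → Continuous fun u => A *ᵥ X u := fun hX =>
    Continuous.matrix_mulVec continuous_const hX
  -- `X₂` is not differentiable because of `B`, but `X₂ - B` is. `Y₁` and `Y₂` are the right-hand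
  -- sides without noise, defined on all of `ℝ`, so that two-sided derivatives exist at the endpoint
  -- 0 although the equations hold only for `u ≥ 0`.
  set Y₁ : ℝ → V → ℝ := fun u j => X₁ 0 j + ∫ v in (0 : ℝ)..u, X₂ v j with hY₁
  set Y₂ : ℝ → V → ℝ := fun u j => X₂ 0 j
      + ∫ v in (0 : ℝ)..u, (-(A *ᵥ X₁ v) j - (A *ᵥ X₂ v) j) with hY₂
  have hY₁' : ∀ u, HasDerivAt Y₁ (X₂ u) u := fun u => hasDerivAt_pi.2 fun j =>
    ((((continuous_apply j).comp hX₂).integral_hasStrictDerivAt 0 u).hasDerivAt).const_add _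
  have hY₂' : ∀ u, HasDerivAt Y₂ (-(A *ᵥ X₁ u) - A *ᵥ X₂ u) u := fun u => hasDerivAt_pi.2 fun j =>
    ((((continuous_apply j).comp ((hAc hX₁).neg.sub (hAc hX₂))).integral_hasStrictDerivAt 0
      u).hasDerivAt).const_add _
  have e₁ : ∀ u, 0 ≤ u → Y₁ u = X₁ u := fun u hu => funext fun j => (h₁ u hu j).symm
  have e₂ : ∀ u, 0 ≤ u → Y₂ u = X₂ u - B u := fun u hu => funext fun j => by
    have := h₂ u hu j
    simp only [hY₂, Pi.sub_apply]
    linarith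
  have hrc : Continuous r := continuous_iff_continuousAt.2 fun u => (h.hasDerivAt_fst u).continuousAt
  have hsc : Continuous s := continuous_iff_continuousAt.2 fun u => (h.hasDerivAt_snd u).continuousAt
  -- The test pair is `(A r, A s)` at time `t - u`. As it solves the adjoint system, the drift
  -- cancels and only the term forced by `B = X₂ - Y₂` survives.
  have hΦ : ∀ u ∈ Set.uIcc 0 t,
      HasDerivAt (fun u => (A *ᵥ r (t - u)) ⬝ᵥ Y₁ u + (A *ᵥ s (t - u)) ⬝ᵥ Y₂ u)
        ((A *ᵥ (r (t - u) - A *ᵥ s (t - u))) ⬝ᵥ B u) u := fun u hu => by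
    rw [Set.uIcc_of_le ht] at hu
    have d₁ := (((h.hasDerivAt_fst (t - u)).comp_const_sub t u).mulVec_const A).dotProduct_vec
      (hY₁' u)
    have d₂ := (((h.hasDerivAt_snd (t - u)).comp_const_sub t u).mulVec_const A).dotProduct_vec
      (hY₂' u)
    refine (d₁.add d₂).congr_deriv ?_
    rw [e₁ u hu.1, e₂ u hu.1]
    simp only [neg_neg, Matrix.mulVec_sub, Matrix.mulVec_neg, dotProduct_sub, sub_dotProduct,
      neg_dotProduct, dotProduct_neg, hA.dotProduct_mulVec_comm]
    ring
  have hcont : Continuous fun u => (A *ᵥ (r (t - u) - A *ᵥ s (t - u))) ⬝ᵥ B u := by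
    have h3 : Continuous fun u => t - u := by fun_prop
    exact (hAc ((hrc.comp h3).sub (hAc (hsc.comp h3)))).dotProduct hB
  have hFTC := intervalIntegral.integral_eq_sub_of_hasDerivAt hΦ (hcont.intervalIntegrable 0 t)
  rw [hFTC]
  have z₂ : Y₂ 0 = X₂ 0 := funext fun j => by simp [hY₂]
  simp only [sub_self, sub_zero, hs0, Matrix.mulVec_zero, zero_dotProduct, e₁ t ht, e₁ 0 le_rfl, z₂]
  ring

/-- The second moment is a quadratic form in `c i` whose coefficients `𝔼[Y j * Y k]` do not depend
on `i`. It is used to discard the initial state. -/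
theorem tendsto_integral_dotProduct_sq {V Ω ι : Type*} [Fintype V] [MeasurableSpace Ω]
    {P : Measure Ω} {l : Filter ι} {Y : Ω → V → ℝ} (hY : ∀ j, MemLp (fun ω => Y ω j) 2 P)
    {c : ι → V → ℝ} (hc : Tendsto c l (𝓝 0)) :
    Tendsto (fun i => ∫ ω, (c i ⬝ᵥ Y ω) ^ 2 ∂P) l (𝓝 0) := by
  have hint : ∀ i j k, Integrable (fun ω => c i j * Y ω j * (c i k * Y ω k)) P := fun i j k =>
    ((hY j).const_mul _).integrable_mul ((hY k).const_mul _)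
  have h1 : ∀ i, ∫ ω, (c i ⬝ᵥ Y ω) ^ 2 ∂P
      = ∑ j, ∑ k, c i j * c i k * ∫ ω, Y ω j * Y ω k ∂P := fun i => by
    simp only [dotProduct, sq, Finset.sum_mul_sum]
    rw [integral_finsetSum _ fun j _ => integrable_finsetSum _ fun k _ => hint i j k]
    refine Finset.sum_congr rfl fun j _ => ?_
    rw [integral_finsetSum _ fun k _ => hint i j k]
    refine Finset.sum_congr rfl fun k _ => ?_
    rw [← integral_const_mul]
    congr 1 with ω
    ring
  simp_rw [h1]
  have h2 : ∀ j, Tendsto (fun i => c i j) l (𝓝 0) := fun j => (tendsto_pi_nhds.1 hc) j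
  have h3 : Tendsto (fun i => ∑ j, ∑ k, c i j * c i k * ∫ ω, Y ω j * Y ω k ∂P) l
      (𝓝 (∑ j : V, ∑ k : V, 0 * 0 * ∫ ω, Y ω j * Y ω k ∂P)) :=
    tendsto_finsetSum _ fun j _ => tendsto_finsetSum _ fun k _ =>
      ((h2 j).mul (h2 k)).mul_const _
  simpa using h3

namespace IsNoisyConsensus

variable {V Ω : Type*} [Fintype V] [DecidableEq V] [MeasurableSpace Ω] {G : SimpleGraph V}
  [DecidableRel G.Adj] {P : Measure Ω} [IsProbabilityMeasure P] {W x₁ x₂ : ℝ≥0 → Ω → V → ℝ}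

/-- On a connected graph, the limiting second moment of the linear statistic `L v · x₁`, where `v`
has zero sum, is half of the squared length of `v`. -/
theorem tendsto_integral_sq (h : IsNoisyConsensus G P W x₁ x₂) (hG : G.Connected) {v : V → ℝ}
    (hv : ∑ i, v i = 0) :
    (∀ t, Integrable (fun ω => ((G.lapMatrix ℝ *ᵥ v) ⬝ᵥ x₁ t ω) ^ 2) P) ∧
      Tendsto (fun t => ∫ ω, ((G.lapMatrix ℝ *ᵥ v) ⬝ᵥ x₁ t ω) ^ 2 ∂P) atTop
        (𝓝 ((v ⬝ᵥ v) / 2)) := by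
  set A := G.lapMatrix ℝ with hAdef
  have hA : A.IsSymm := G.isSymm_lapMatrix (R := ℝ)
  obtain ⟨r, s, hrs, hr0, hs0⟩ := exists_isAdjointFlow A v
  have hr0' : ∑ i, r 0 i = 0 := by rw [hr0, hv]
  have hs0' : ∑ i, s 0 i = 0 := by simp [hs0]
  have hAc : Continuous fun x : V → ℝ => A *ᵥ x :=
    Continuous.matrix_mulVec continuous_const continuous_id
  have hrc : Continuous r :=
    continuous_iff_continuousAt.2 fun u => (hrs.hasDerivAt_fst u).continuousAt
  have hsc : Continuous s :=
    continuous_iff_continuousAt.2 fun u => (hrs.hasDerivAt_snd u).continuousAt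
  have hcoe : Tendsto (fun t : ℝ≥0 => (t : ℝ)) atTop atTop := NNReal.tendsto_coe_atTop.2 tendsto_id
  have hrlim : Tendsto (fun t : ℝ≥0 => A *ᵥ r t) atTop (𝓝 0) := by
    have := (hAc.tendsto 0).comp ((hrs.tendsto_fst hG hr0' hs0').comp hcoe)
    rwa [Matrix.mulVec_zero] at this
  have hslim : Tendsto (fun t : ℝ≥0 => A *ᵥ s t) atTop (𝓝 0) := by
    have := (hAc.tendsto 0).comp ((hrs.tendsto_snd hG hr0' hs0').comp hcoe)
    rwa [Matrix.mulVec_zero] at this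
  set Z : ℝ≥0 → Ω → ℝ := fun t ω =>
    ∫ u in (0 : ℝ)..t, (A *ᵥ (r (t - u) - A *ᵥ s (t - u))) ⬝ᵥ W u.toNNReal ω with hZ
  have hpath : ∀ᵐ ω ∂P, ∀ t : ℝ≥0, (A *ᵥ v) ⬝ᵥ x₁ t ω
      = (A *ᵥ r t) ⬝ᵥ x₁ 0 ω + ((A *ᵥ s t) ⬝ᵥ x₂ 0 ω + Z t ω) := by
    have hWc : ∀ᵐ ω ∂P, ∀ j, Continuous fun t => W t ω j :=
      ae_all_iff.2 fun j => (h.noise.isBrownianReal j).cont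
    filter_upwards [h.continuous_fst, h.continuous_snd, h.fst_eq, h.snd_eq, hWc]
      with ω c₁ c₂ q₁ q₂ cW t
    have key := hrs.variation_of_parameters hA hs0 (X₁ := fun u => x₁ u.toNNReal ω)
      (X₂ := fun u => x₂ u.toNNReal ω) (B := fun u => W u.toNNReal ω)
      (c₁.comp continuous_real_toNNReal) (c₂.comp continuous_real_toNNReal)
      ((continuous_pi cW).comp continuous_real_toNNReal)
      (fun u hu j => by
        have := q₁ u.toNNReal j
        rw [Real.coe_toNNReal u hu] at this
        simpa using this)
      (fun u hu j => by
        have := q₂ u.toNNReal j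
        rw [Real.coe_toNNReal u hu] at this
        simpa using this) t.coe_nonneg
    simpa [hr0] using key
  have hnoise : ∀ t : ℝ≥0, MemLp (Z t) 2 P ∧
      ∫ ω, Z t ω ^ 2 ∂P = (v ⬝ᵥ v - (r t ⬝ᵥ r t + s t ⬝ᵥ (A *ᵥ s t))) / 2 := fun t => by
    have h3 : Continuous fun u => (t : ℝ) - u := by fun_prop
    obtain ⟨h4, h5⟩ := h.noise.wiener_isometry
      (g := fun u => A *ᵥ (r (t - u) - A *ᵥ s (t - u))) (Q := fun u => A *ᵥ s (t - u))
      (hAc.comp ((hrc.comp h3).sub (hAc.comp (hsc.comp h3))))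
      (fun u => (((hrs.hasDerivAt_snd (t - u)).comp_const_sub (t : ℝ) u).mulVec_const A).congr_deriv
        (by rw [Matrix.mulVec_neg])) t.coe_nonneg (by simp [hs0])
    refine ⟨h4, h5.trans ?_⟩
    -- Half the energy at time `t - u` is a primitive of the isometry integrand, because the time
    -- reversal flips the sign of the dissipation.
    have hder : ∀ u ∈ Set.uIcc 0 (t : ℝ), HasDerivAt
        (fun u => (r (t - u) ⬝ᵥ r (t - u) + s (t - u) ⬝ᵥ (A *ᵥ s (t - u))) / 2)
        ((A *ᵥ s (t - u)) ⬝ᵥ (A *ᵥ s (t - u))) u := fun u _ =>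
      (((hrs.hasDerivAt_energy hA (t - u)).comp_const_sub (t : ℝ) u).div_const 2).congr_deriv
        (by ring)
    have hcont : Continuous fun u => (A *ᵥ s (t - u)) ⬝ᵥ (A *ᵥ s (t - u)) :=
      (hAc.comp (hsc.comp h3)).dotProduct (hAc.comp (hsc.comp h3))
    rw [intervalIntegral.integral_eq_sub_of_hasDerivAt hder (hcont.intervalIntegrable _ _)]
    simp only [sub_self, sub_zero, hr0, hs0, zero_dotProduct, add_zero]
    ring
  have hm₁ : ∀ t : ℝ≥0, MemLp (fun ω => (A *ᵥ r t) ⬝ᵥ x₁ 0 ω) 2 P := fun t =>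
    memLp_finsetSum _ fun j _ => (h.memLp_fst_zero j).const_mul _
  have hm₂ : ∀ t : ℝ≥0, MemLp (fun ω => (A *ᵥ s t) ⬝ᵥ x₂ 0 ω) 2 P := fun t =>
    memLp_finsetSum _ fun j _ => (h.memLp_snd_zero j).const_mul _
  have hsq : ∀ t : ℝ≥0, (fun ω => ((A *ᵥ v) ⬝ᵥ x₁ t ω) ^ 2) =ᵐ[P]
      fun ω => ((A *ᵥ r t) ⬝ᵥ x₁ 0 ω + ((A *ᵥ s t) ⬝ᵥ x₂ 0 ω + Z t ω)) ^ 2 := fun t => by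
    filter_upwards [hpath] with ω hω
    rw [hω t]
  refine ⟨fun t => ?_, ?_⟩
  · exact ((hm₁ t).add ((hm₂ t).add (hnoise t).1)).integrable_sq.congr (hsq t).symm
  · simp_rw [integral_congr_ae (hsq _)]
    refine tendsto_integral_add_sq hm₁ (fun t => (hm₂ t).add (hnoise t).1)
      (tendsto_integral_dotProduct_sq h.memLp_fst_zero hrlim) ?_
    refine tendsto_integral_add_sq hm₂ (fun t => (hnoise t).1)
      (tendsto_integral_dotProduct_sq h.memLp_snd_zero hslim) ?_
    simp_rw [(hnoise _).2]
    simpa using (((hrs.tendsto_energy hG hr0' hs0').comp hcoe).const_sub (v ⬝ᵥ v)).div_const 2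

end IsNoisyConsensus

/-! ### Potentials on the cycle -/

/-- The two boundary conditions are exactly what the wrap-around neighbours of the vertices `0` and
`N - 1` need for the Laplacian to become a second difference on the line. -/
theorem cycleGraph_lapMatrix_mulVec {N : ℕ} (hN : 3 ≤ N) {φ : ℝ → ℝ} (h₁ : φ (-1) = φ (N - 1))
    (h₂ : φ N = φ 0) (i : Fin N) :
    ((SimpleGraph.cycleGraph N).lapMatrix ℝ *ᵥ fun i => φ i) i
      = 2 * φ i - φ (i - 1) - φ (i + 1) := by
  obtain ⟨n, rfl⟩ := Nat.exists_eq_add_of_le' hN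
  -- If the two neighbours coincided, the degree would be 1 instead of 2; this is where `N ≥ 3`
  -- enters.
  have hne : i - 1 ≠ i + 1 := fun h => by
    have h3 := SimpleGraph.cycleGraph_degree_three_le (n := n) (v := i)
    rw [← SimpleGraph.card_neighborFinset_eq_degree, SimpleGraph.cycleGraph_neighborFinset, h] at h3
    simp at h3
  have hsub : φ ((i - 1 : Fin (n + 3)) : ℕ) = φ ((i : ℕ) - 1) := by
    rw [Fin.coe_sub_one]
    split_ifs with hi
    · subst hi
      simp only [Fin.val_zero, Nat.cast_zero, zero_sub, h₁]
      push_cast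
      ring_nf
    · have : 1 ≤ (i : ℕ) := Nat.one_le_iff_ne_zero.2 fun h => hi (Fin.ext h)
      rw [Nat.cast_sub this, Nat.cast_one]
  have hadd : φ ((i + 1 : Fin (n + 3)) : ℕ) = φ ((i : ℕ) + 1) := by
    rw [Fin.val_add_one]
    split_ifs with hi
    · subst hi
      rw [Nat.cast_zero, ← h₂]
      simp only [Fin.val_last]
      push_cast
      ring_nf
    · push_cast
      rfl
  rw [SimpleGraph.lapMatrix_mulVec_apply, SimpleGraph.cycleGraph_degree_three_le,
    SimpleGraph.cycleGraph_neighborFinset, Finset.sum_pair hne, hsub, hadd]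
  push_cast
  ring

/-- Subtracting the mean from `φ` leaves its Laplacian unchanged and makes it admissible as `v`, so
potentials need no normalisation. -/
theorem IsNoisyConsensus.tendsto_integral_sq_of_potential {N : ℕ} (hN : 3 ≤ N) {Ω : Type*}
    [MeasurableSpace Ω] {P : Measure Ω} [IsProbabilityMeasure P] {W x₁ x₂ : ℝ≥0 → Ω → Fin N → ℝ}
    (h : IsNoisyConsensus (SimpleGraph.cycleGraph N) P W x₁ x₂) {φ : ℝ → ℝ}
    (h₁ : φ (-1) = φ (N - 1)) (h₂ : φ N = φ 0) {a : Fin N → ℝ}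
    (ha : ∀ i : Fin N, 2 * φ i - φ (i - 1) - φ (i + 1) = a i) :
    (∀ t, Integrable (fun ω => (a ⬝ᵥ x₁ t ω) ^ 2) P) ∧
      Tendsto (fun t => ∫ ω, (a ⬝ᵥ x₁ t ω) ^ 2 ∂P) atTop
        (𝓝 ((∑ i ∈ Finset.range N, φ i ^ 2 - (∑ i ∈ Finset.range N, φ i) ^ 2 / N) / 2)) := by
  have hN0 : (N : ℝ) ≠ 0 := by positivity
  set m : ℝ := (∑ i ∈ Finset.range N, φ i) / N with hm
  have hconn : (SimpleGraph.cycleGraph N).Connected := by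
    obtain ⟨n, rfl⟩ := Nat.exists_eq_add_of_le' hN
    exact SimpleGraph.cycleGraph_connected
  have hsum : ∑ i : Fin N, φ i = m * N := by
    rw [Fin.sum_univ_eq_sum_range (fun i => φ i), hm, div_mul_cancel₀ _ hN0]
  have hv : ∑ i : Fin N, (φ i - m) = 0 := by
    rw [Finset.sum_sub_distrib, hsum]
    simp [mul_comm]
  have hL : (SimpleGraph.cycleGraph N).lapMatrix ℝ *ᵥ (fun i : Fin N => φ i - m) = a := by
    funext i
    rw [cycleGraph_lapMatrix_mulVec hN (φ := fun x => φ x - m) (by rw [h₁]) (by rw [h₂]), ← ha i]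
    ring
  have hsq : (fun i : Fin N => φ i - m) ⬝ᵥ (fun i : Fin N => φ i - m)
      = ∑ i ∈ Finset.range N, φ i ^ 2 - (∑ i ∈ Finset.range N, φ i) ^ 2 / N := by
    have e : ∀ i : Fin N, (φ i - m) * (φ i - m) = φ i ^ 2 - 2 * m * φ i + m ^ 2 := fun i => by ring
    simp only [dotProduct, e]
    rw [Finset.sum_add_distrib, Finset.sum_sub_distrib, ← Finset.mul_sum, hsum,
      Fin.sum_univ_eq_sum_range (fun i => φ i ^ 2), Finset.sum_const, Finset.card_univ,
      Fintype.card_fin, nsmul_eq_mul]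
    have : ∑ i ∈ Finset.range N, φ i = m * N := by rw [hm, div_mul_cancel₀ _ hN0]
    rw [this]
    field_simp
    ring
  rw [← hsq, ← hL]
  exact h.tendsto_integral_sq hconn hv

/-- The positive part is a discrete Green function on the line: it is linear on each side of its
kink at the origin. It is the building block of both potentials. -/
theorem two_mul_max_sub_max_sub_max (x : ℤ) :
    2 * max (0 : ℝ) x - max (0 : ℝ) (x - 1) - max (0 : ℝ) (x + 1) = if x = 0 then -1 else 0 := by
  rcases lt_trichotomy x 0 with h | h | h
  · have h1 : (x : ℝ) + 1 ≤ 0 := by exact_mod_cast h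
    rw [max_eq_left (by linarith), max_eq_left (by linarith), max_eq_left h1, if_neg h.ne]
    norm_num
  · subst h
    norm_num
  · have h1 : (1 : ℝ) ≤ x := by exact_mod_cast h
    rw [max_eq_right (by linarith), max_eq_right (by linarith), max_eq_right (by linarith),
      if_neg h.ne']
    ring

theorem two_mul_posPart_sub {i k : ℕ} :
    2 * max (0 : ℝ) (i - k) - max (0 : ℝ) (i - 1 - k) - max (0 : ℝ) (i + 1 - k)
      = if i = k then -1 else 0 := by
  have h := two_mul_max_sub_max_sub_max ((i : ℤ) - k)
  push_cast at h
  rw [sub_right_comm (i : ℝ) 1, add_sub_right_comm, h]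
  simp only [sub_eq_zero, Nat.cast_inj]

/-! ### Power sums, plain and truncated -/

theorem sum_range_id_real (n : ℕ) : ∑ i ∈ Finset.range n, (i : ℝ) = n * (n - 1) / 2 := by
  induction n with
  | zero => simp
  | succ n ih => rw [Finset.sum_range_succ, ih]; push_cast; ring

theorem sum_range_sq_real (n : ℕ) :
    ∑ i ∈ Finset.range n, (i : ℝ) ^ 2 = n * (n - 1) * (2 * n - 1) / 6 := by
  induction n with
  | zero => simp
  | succ n ih => rw [Finset.sum_range_succ, ih]; push_cast; ring

theorem sum_range_cube_real (n : ℕ) :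
    ∑ i ∈ Finset.range n, (i : ℝ) ^ 3 = n ^ 2 * (n - 1) ^ 2 / 4 := by
  induction n with
  | zero => simp
  | succ n ih => rw [Finset.sum_range_succ, ih]; push_cast; ring

theorem sum_range_fourth_real (n : ℕ) :
    ∑ i ∈ Finset.range n, (i : ℝ) ^ 4
      = n * (n - 1) * (2 * n - 1) * (3 * n ^ 2 - 3 * n - 1) / 30 := by
  induction n with
  | zero => simp
  | succ n ih => rw [Finset.sum_range_succ, ih]; push_cast; ring

theorem sum_range_max_sub_pow {k N : ℕ} (hk : k ≤ N) {p : ℕ} (hp : p ≠ 0) :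
    ∑ i ∈ Finset.range N, max (0 : ℝ) (i - k) ^ p = ∑ m ∈ Finset.range (N - k), (m : ℝ) ^ p := by
  obtain ⟨M, rfl⟩ := Nat.exists_eq_add_of_le hk
  rw [Finset.sum_range_add, Finset.sum_eq_zero, zero_add, Nat.add_sub_cancel_left]
  · refine Finset.sum_congr rfl fun m _ => ?_
    push_cast
    rw [add_sub_cancel_left, max_eq_right (Nat.cast_nonneg m)]
  · intro i hi
    have : (i : ℝ) ≤ k := by exact_mod_cast (Finset.mem_range.1 hi).le
    rw [max_eq_left (by linarith), zero_pow hp]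

theorem max_mul_self_eq (x : ℝ) : x * max 0 x = max 0 x ^ 2 := by
  rcases le_total x 0 with h | h
  · simp [max_eq_left h]
  · rw [max_eq_right h, sq]

theorem sub_mul_max_sub {x y z : ℝ} (h : y ≤ z) :
    max 0 (x - y) * max 0 (x - z) = max 0 (x - z) ^ 2 + (z - y) * max 0 (x - z) := by
  rcases le_total x z with h1 | h1
  · simp [max_eq_left (sub_nonpos.2 h1)]
  · rw [max_eq_right (sub_nonneg.2 h1), max_eq_right (sub_nonneg.2 (h.trans h1))]
    ring

/-! ### The three variances on the cycle -/

namespace IsNoisyConsensus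

variable {N : ℕ} {Ω : Type*} [MeasurableSpace Ω] {P : Measure Ω} [IsProbabilityMeasure P]
  {W x₁ x₂ : ℝ≥0 → Ω → Fin N → ℝ}

theorem hasPairwiseVariance_cycleGraph (hN : 3 ≤ N)
    (h : IsNoisyConsensus (SimpleGraph.cycleGraph N) P W x₁ x₂) {j k : Fin N} {l : ℕ}
    (hkj : k ≤ j) (hl : (j : ℕ) - (k : ℕ) = l) :
    HasPairwiseVariance P x₁ j k
      ((l : ℝ) ^ 4 / (24 * N) - (l : ℝ) ^ 3 / 12 + (l : ℝ) ^ 2 * N / 24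
        - (l : ℝ) ^ 2 / (12 * N) + (l : ℝ) / 12) := by
  have hN0 : (N : ℝ) ≠ 0 := by positivity
  have hkj' : (k : ℕ) ≤ j := hkj
  have hkN : (k : ℕ) ≤ N := k.2.le
  have hjN : (j : ℕ) ≤ N := j.2.le
  have hlr : (l : ℝ) = (j : ℕ) - (k : ℕ) := by rw [← hl, Nat.cast_sub hkj']
  have hkr : ((k : ℕ) : ℝ) + 1 ≤ N := by exact_mod_cast k.2
  have hjr : ((j : ℕ) : ℝ) + 1 ≤ N := by exact_mod_cast j.2
  have hkjr : ((k : ℕ) : ℝ) ≤ (j : ℕ) := by exact_mod_cast hkj'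
  have hk0 : (0 : ℝ) ≤ (k : ℕ) := Nat.cast_nonneg _
  have hj0 : (0 : ℝ) ≤ (j : ℕ) := Nat.cast_nonneg _
  -- The kinks at `k` and `j` produce `-1` and `+1` under the Laplacian. The linear term is
  -- invisible to second differences, and its slope `l / N` is the one that closes `φ` up around the
  -- cycle.
  set φ : ℝ → ℝ := fun x => max 0 (x - (k : ℕ)) - max 0 (x - (j : ℕ)) - l / N * x with hφ
  have key := h.tendsto_integral_sq_of_potential hN (φ := φ)
    (a := Pi.single j 1 - Pi.single k 1) ?_ ?_ fun i => ?_
  · have hdot : ∀ t ω, (Pi.single j 1 - Pi.single k 1 : Fin N → ℝ) ⬝ᵥ x₁ t ω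
        = x₁ t ω j - x₁ t ω k := fun t ω => by
      rw [sub_dotProduct, single_one_dotProduct, single_one_dotProduct]
    simp only [hdot] at key
    refine ⟨key.1, ?_⟩
    convert key.2 using 2
    have s₁ := fun (c : Fin N) => sum_range_max_sub_pow c.2.le one_ne_zero
    have s₂ := fun (c : Fin N) => sum_range_max_sub_pow c.2.le two_ne_zero
    simp only [pow_one, sum_range_id_real, sum_range_sq_real, Nat.cast_sub (Fin.is_lt _).le] at s₁ s₂
    have e₁ : ∑ i ∈ Finset.range N, φ i = (∑ i ∈ Finset.range N, max (0 : ℝ) (i - (k : ℕ)))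
        - (∑ i ∈ Finset.range N, max (0 : ℝ) (i - (j : ℕ)))
        - l / N * ∑ i ∈ Finset.range N, (i : ℝ) := by
      simp only [hφ, Finset.sum_sub_distrib, Finset.mul_sum]
    -- The products of truncated linear functions are reduced to single truncated powers, the mixed
    -- one by `k ≤ j`, so that only known power sums remain.
    have e₂ : ∑ i ∈ Finset.range N, φ i ^ 2
        = (1 - 2 * (l / N)) * (∑ i ∈ Finset.range N, max (0 : ℝ) (i - (k : ℕ)) ^ 2)
        - 2 * (l / N) * (k : ℕ) * (∑ i ∈ Finset.range N, max (0 : ℝ) (i - (k : ℕ)))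
        + (2 * (l / N) - 1) * (∑ i ∈ Finset.range N, max (0 : ℝ) (i - (j : ℕ)) ^ 2)
        + (2 * (l / N) * (j : ℕ) - 2 * l) * (∑ i ∈ Finset.range N, max (0 : ℝ) (i - (j : ℕ)))
        + (l / N) ^ 2 * ∑ i ∈ Finset.range N, (i : ℝ) ^ 2 := by
      simp only [Finset.mul_sum, ← Finset.sum_sub_distrib, ← Finset.sum_add_distrib]
      refine Finset.sum_congr rfl fun i _ => ?_
      have m₁ := max_mul_self_eq ((i : ℝ) - (k : ℕ))
      have m₂ := max_mul_self_eq ((i : ℝ) - (j : ℕ))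
      have m₃ := sub_mul_max_sub (x := i) hkjr
      rw [← hlr] at m₃
      simp only [hφ]
      linear_combination (-2 * (l / N : ℝ)) * m₁ + (2 * (l / N : ℝ)) * m₂ - 2 * m₃
    rw [e₁, e₂, s₁, s₁, s₂, s₂, sum_range_id_real, sum_range_sq_real, hlr]
    field_simp
    ring
  · simp only [hφ]
    rw [max_eq_left (by linarith), max_eq_left (by linarith), max_eq_right (by linarith),
      max_eq_right (by linarith), hlr]
    field_simp
    ring
  · simp only [hφ]
    rw [max_eq_right (by linarith), max_eq_right (by linarith), max_eq_left (by linarith),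
      max_eq_left (by linarith), hlr]
    field_simp
    ring
  · have p₁ := two_mul_posPart_sub (i := i) (k := k)
    have p₂ := two_mul_posPart_sub (i := i) (k := j)
    simp only [hφ, Pi.sub_apply, Pi.single_apply, Fin.ext_iff]
    split_ifs at p₁ p₂ ⊢ <;> linarith

theorem hasVertexVariance_cycleGraph (hN : 3 ≤ N)
    (h : IsNoisyConsensus (SimpleGraph.cycleGraph N) P W x₁ x₂) (j : Fin N) :
    HasVertexVariance P x₁ j (((N : ℝ) ^ 3 + 10 * N - 11 / N) / 1440) := by
  have hN0 : (N : ℝ) ≠ 0 := by positivity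
  have hjr : ((j : ℕ) : ℝ) + 1 ≤ N := by exact_mod_cast j.2
  have hj0 : (0 : ℝ) ≤ (j : ℕ) := Nat.cast_nonneg _
  -- With `y = x - j` this is `y² / (2N) - |y| / 2`. The quadratic contributes the constant `-1 /
  -- N`, the kink contributes `+1` at `j`, and the function is symmetric about `j`, with equal
  -- values at `0` and `N` and at `-1` and `N - 1`.
  set φ : ℝ → ℝ := fun x => (x - (j : ℕ)) ^ 2 / (2 * N) + (x - (j : ℕ)) / 2
    - max 0 (x - (j : ℕ)) with hφ
  have key := h.tendsto_integral_sq_of_potential hN (φ := φ)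
    (a := Pi.single j 1 - fun _ => (N : ℝ)⁻¹) ?_ ?_ fun i => ?_
  · have hdot : ∀ t ω, (Pi.single j 1 - (fun _ => (N : ℝ)⁻¹) : Fin N → ℝ) ⬝ᵥ x₁ t ω
        = x₁ t ω j - vertexAverage (x₁ t ω) := fun t ω => by
      rw [sub_dotProduct, single_one_dotProduct, vertexAverage, Fintype.card_fin, dotProduct,
        ← Finset.mul_sum, div_eq_inv_mul]
    simp only [hdot] at key
    refine ⟨key.1, ?_⟩
    convert key.2 using 2
    have s₁ := sum_range_max_sub_pow j.2.le one_ne_zero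
    have s₃ := sum_range_max_sub_pow j.2.le three_ne_zero
    simp only [pow_one, sum_range_id_real, sum_range_cube_real, Nat.cast_sub j.2.le] at s₁ s₃
    have hconst : ∀ c : ℝ, N * c = ∑ _i ∈ Finset.range N, c := fun c => by simp
    have e₁ : ∑ i ∈ Finset.range N, φ i
        = 1 / (2 * N) * (∑ i ∈ Finset.range N, (i : ℝ) ^ 2)
        + (1 / 2 - (j : ℕ) / N) * (∑ i ∈ Finset.range N, (i : ℝ))
        + N * ((j : ℕ) ^ 2 / (2 * N) - (j : ℕ) / 2)
        - ∑ i ∈ Finset.range N, max (0 : ℝ) (i - (j : ℕ)) := by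
      rw [hconst]
      simp only [Finset.mul_sum, ← Finset.sum_sub_distrib,
        ← Finset.sum_add_distrib]
      refine Finset.sum_congr rfl fun i _ => ?_
      simp only [hφ]
      field_simp
      ring
    have e₂ : ∑ i ∈ Finset.range N, φ i ^ 2
        = 1 / (4 * N ^ 2) * (∑ i ∈ Finset.range N, (i : ℝ) ^ 4)
        + (1 / (2 * N) - (j : ℕ) / N ^ 2) * (∑ i ∈ Finset.range N, (i : ℝ) ^ 3)
        + (6 * (j : ℕ) ^ 2 / (4 * N ^ 2) - 3 * (j : ℕ) / (2 * N) + 1 / 4)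
          * (∑ i ∈ Finset.range N, (i : ℝ) ^ 2)
        + (- (j : ℕ) ^ 3 / N ^ 2 + 3 * (j : ℕ) ^ 2 / (2 * N) - (j : ℕ) / 2)
          * (∑ i ∈ Finset.range N, (i : ℝ))
        + N * ((j : ℕ) ^ 4 / (4 * N ^ 2) - (j : ℕ) ^ 3 / (2 * N) + (j : ℕ) ^ 2 / 4)
        - 1 / N * ∑ i ∈ Finset.range N, max (0 : ℝ) (i - (j : ℕ)) ^ 3 := by
      rw [hconst]
      simp only [Finset.mul_sum, ← Finset.sum_sub_distrib,
        ← Finset.sum_add_distrib]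
      refine Finset.sum_congr rfl fun i _ => ?_
      have m₁ := max_mul_self_eq ((i : ℝ) - (j : ℕ))
      simp only [hφ]
      generalize max (0 : ℝ) (i - (j : ℕ)) = y at *
      have m₂ : ((i : ℝ) - (j : ℕ)) ^ 2 * y = y ^ 3 := by
        linear_combination ((i : ℝ) - (j : ℕ)) * m₁ + y * m₁
      -- The square of `y` and the cross term coming from the linear part cancel, so the kink enters
      -- only through its cube.
      have m₃ : ((((i : ℝ) - (j : ℕ)) ^ 2 / (2 * N) + ((i : ℝ) - (j : ℕ)) / 2) - y) ^ 2
          = (((i : ℝ) - (j : ℕ)) ^ 2 / (2 * N) + ((i : ℝ) - (j : ℕ)) / 2) ^ 2 - 1 / N * y ^ 3 := by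
        rw [← m₂]
        linear_combination - m₁
      rw [m₃]
      field_simp
      ring
    rw [e₁, e₂, s₁, s₃, sum_range_id_real, sum_range_sq_real, sum_range_cube_real,
      sum_range_fourth_real]
    field_simp
    ring
  · simp only [hφ]
    rw [max_eq_left (by linarith), max_eq_right (by linarith)]
    field_simp
    ring
  · simp only [hφ]
    rw [max_eq_right (by linarith), max_eq_left (by linarith)]
    field_simp
    ring
  · have p₂ := two_mul_posPart_sub (i := i) (k := j)
    have q : 2 * (((i : ℕ) - (j : ℕ) : ℝ) ^ 2 / (2 * N) + ((i : ℕ) - (j : ℕ) : ℝ) / 2)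
        - (((i : ℕ) - 1 - (j : ℕ) : ℝ) ^ 2 / (2 * N) + ((i : ℕ) - 1 - (j : ℕ) : ℝ) / 2)
        - (((i : ℕ) + 1 - (j : ℕ) : ℝ) ^ 2 / (2 * N) + ((i : ℕ) + 1 - (j : ℕ) : ℝ) / 2)
        = -(N : ℝ)⁻¹ := by
      field_simp
      ring
    simp only [hφ, Pi.sub_apply, Pi.single_apply, Fin.ext_iff]
    split_ifs at p₂ ⊢ <;> linarith

theorem hasTotalVariance_cycleGraph (hN : 3 ≤ N)
    (h : IsNoisyConsensus (SimpleGraph.cycleGraph N) P W x₁ x₂) :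
    HasTotalVariance P x₁ (((N : ℝ) ^ 4 + 10 * (N : ℝ) ^ 2 - 11) / 1440) := by
  have hN0 : (N : ℝ) ≠ 0 := by positivity
  refine ⟨fun t j => (h.hasVertexVariance_cycleGraph hN j).1 t, ?_⟩
  have h1 := tendsto_finsetSum (Finset.univ : Finset (Fin N))
    fun j _ => (h.hasVertexVariance_cycleGraph hN j).2
  convert h1 using 2
  rw [Finset.sum_const, Finset.card_univ, Fintype.card_fin, nsmul_eq_mul]
  field_simp

end IsNoisyConsensus

/-! ### Growth rate and conclusion -/

theorem isTheta_totalVariance_cycleGraph :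
    (fun N : ℕ => ((N : ℝ) ^ 4 + 10 * (N : ℝ) ^ 2 - 11) / 1440) =Θ[atTop]
      fun N : ℕ => (N : ℝ) ^ 4 := by
  constructor
  · refine IsBigO.of_bound 1 ?_
    filter_upwards [eventually_ge_atTop 2] with N hN
    have h1 : (2 : ℝ) ≤ N := by exact_mod_cast hN
    rw [Real.norm_of_nonneg (by nlinarith), Real.norm_of_nonneg (by positivity)]
    nlinarith [sq_nonneg ((N : ℝ) ^ 2 - 1)]
  · refine IsBigO.of_bound 1440 ?_
    filter_upwards [eventually_ge_atTop 2] with N hN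
    have h1 : (2 : ℝ) ≤ N := by exact_mod_cast hN
    rw [Real.norm_of_nonneg (by positivity),
      Real.norm_of_nonneg (by nlinarith [sq_nonneg ((N : ℝ) ^ 2)])]
    nlinarith

theorem mainTheorem9 :
    (∀ (N : ℕ), 3 ≤ N →
      ∀ (Ω : Type*) [MeasurableSpace Ω] (P : Measure Ω) [IsProbabilityMeasure P]
        (W x₁ x₂ : ℝ≥0 → Ω → Fin N → ℝ),
        IsNoisyConsensus (SimpleGraph.cycleGraph N) P W x₁ x₂ →
        (∀ (j k : Fin N) (l : ℕ), k ≤ j → (j : ℕ) - (k : ℕ) = l →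
          HasPairwiseVariance P x₁ j k
            ((l : ℝ) ^ 4 / (24 * N) - (l : ℝ) ^ 3 / 12 + (l : ℝ) ^ 2 * N / 24
              - (l : ℝ) ^ 2 / (12 * N) + (l : ℝ) / 12)) ∧
        (∀ j : Fin N,
          HasVertexVariance P x₁ j (((N : ℝ) ^ 3 + 10 * N - 11 / N) / 1440)) ∧
        HasTotalVariance P x₁ (((N : ℝ) ^ 4 + 10 * (N : ℝ) ^ 2 - 11) / 1440)) ∧
    (∀ (Ω : ℕ → Type*) [∀ N, MeasurableSpace (Ω N)] (P : ∀ N, Measure (Ω N))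
      [∀ N, IsProbabilityMeasure (P N)] (W x₁ x₂ : ∀ N, ℝ≥0 → Ω N → Fin N → ℝ) (H : ℕ → ℝ),
      (∀ N, 3 ≤ N → IsNoisyConsensus (SimpleGraph.cycleGraph N) (P N) (W N) (x₁ N) (x₂ N)) →
      (∀ N, 3 ≤ N → HasTotalVariance (P N) (x₁ N) (H N)) →
      H =Θ[atTop] fun N : ℕ => (N : ℝ) ^ 4) := by
  refine ⟨fun N hN Ω _ P _ W x₁ x₂ h => ⟨fun j k l hkj hl => ?_, fun j => ?_, ?_⟩,
    fun Ω _ P _ W x₁ x₂ H h hH => ?_⟩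
  · exact h.hasPairwiseVariance_cycleGraph hN hkj hl
  · exact h.hasVertexVariance_cycleGraph hN j
  · exact h.hasTotalVariance_cycleGraph hN
  -- For `N ≥ 3`, uniqueness of limits forces `H N` to be the closed form; smaller `N` do not affect
  -- the asymptotics.
  · refine (EventuallyEq.isTheta ?_).trans isTheta_totalVariance_cycleGraph
    filter_upwards [eventually_ge_atTop 3] with N hN
    exact tendsto_nhds_unique (hH N hN).2 ((h N hN).hasTotalVariance_cycleGraph hN).2
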